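/- Let $\mathbb D$ be the open unit disc and let $\beta=(\beta_k)_{k\ge 0}$ be a decreasing (i.e. non-increasing) sequence of positive real numbers with $\liminf_{k\to\infty}\beta_k^{1/k}\ge 1$. Let $H^2(\beta)$ be the Hilbert space of analytic functions $f(z)=\sum_{k\ge0}c_kz^k$ on $\mathbb D$ with $\|f\|_{H^2(\beta)}^2:=\sum_{k\ge 0}\beta_k|c_k|^2<\infty$; for $a\in\mathbb D$ let $K_a\in H^2(\beta)$ be its reproducing kernel, so that $f(a)=\langle f,K_a\rangle$ for all $f\in H^2(\beta)$. Assume that every automorphism $\varphi$ of $\mathbb D$ (biholomorphic self-map) induces a bounded composition operator $f\mapsto f\circ\varphi$ on $H=H^2(\beta)$. Then $H$ is admissible, i.e. it is a Hilbert space of analytic functions on $\mathbb D$ with reproducing kernels, it contains the constants, and: (i) the Hardy space $H^2$ (the analytic $f$ on $\mathbb D$ with $\|f\|_{H^2}^2=\sup_{0<r<1}\frac1{2\pi}\int_0^{2\pi}|f(re^{it})|^2\,dt<\infty$) is contained in $H$, and there is a constant $C$ with $\|f\|_H\le C\|f\|_{H^2}$ for all $f\in H^2$; (ii) the set of multipliers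 $\mathcal M(H)=\{w\in H : wf\in H\text{ for all }f\in H\}$ is equal to $H^\infty$, the set of bounded analytic functions on $\mathbb D$; (iii) all automorphisms of $\mathbb D$ induce bounded composition operators on $H$; (iv) there are a non-decreasing function $h:[0,\infty)\to[0,\infty)$ and a number $r<1$ such that for all $a,b\in\mathbb D$ with $|a|>r$ and $|b|>r$, $$\frac{\|K_a\|_H}{\|K_b\|_H}\le h\left(\frac{1-|b|}{1-|a|}\right).$$ Moreover, for every $w\in H^\infty$ the multiplication operator $M_w:f\mapsto wf$ is bounded on $H$ and has operator norm $\|M_w\|=\sup_{z\in\mathbb D}|w(z)|$. -/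

import Mathlib

open scoped Complex.UnitDisc InnerProductSpace

noncomputable section

namespace DiscSpaces

/-! ### Analytic functions on the unit disc, the Hardy space `H²` and the algebra `H^∞` -/

/-- Extension by zero to the whole plane of a function on the open unit disc. -/
def extend (f : 𝔻 → ℂ) (z : ℂ) : ℂ :=
  if hz : ‖z‖ < 1 then f (Complex.UnitDisc.mk z hz) else 0

/-- `f : 𝔻 → ℂ` is analytic on the open unit disc. -/
def IsAnalytic (f : 𝔻 → ℂ) : Prop :=
  AnalyticOnNhd ℂ (extend f) (Metric.ball 0 1)

/-- The mean of `|f|²` over the circle of radius `r` centred at the origin, with respect to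
the normalized arc length. -/
def meanSq (f : 𝔻 → ℂ) (r : ℝ) : ℝ :=
  Real.circleAverage (fun z => ‖extend f z‖ ^ 2) 0 r

/-- The Hardy space `H²` as a set of functions: the analytic functions on the disc whose means
`meanSq f r`, `0 < r < 1`, are bounded. -/
def hardySpace : Set (𝔻 → ℂ) :=
  {f | IsAnalytic f ∧ BddAbove (Set.range fun r : Set.Ioo (0 : ℝ) 1 => meanSq f r)}

/-- The norm of the Hardy space `H²`. -/
def hardyNorm (f : 𝔻 → ℂ) : ℝ :=
  √(⨆ r : Set.Ioo (0 : ℝ) 1, meanSq f r)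

/-- The set `H^∞` of bounded analytic functions on the disc. -/
def hInfty : Set (𝔻 → ℂ) :=
  {w | IsAnalytic w ∧ BddAbove (Set.range fun z : 𝔻 => ‖w z‖)}

/-- The supremum norm on `H^∞`. -/
def supNorm (w : 𝔻 → ℂ) : ℝ :=
  ⨆ z : 𝔻, ‖w z‖

/-- A (biholomorphic) automorphism of the unit disc. -/
def IsDiscAutomorphism (φ : 𝔻 → 𝔻) : Prop :=
  Function.Bijective φ ∧ IsAnalytic (fun z => (φ z : ℂ))

/-! ### Admissible Hilbert spaces of functions on the disc

Mathlib's class `RKHS ℂ H 𝔻 ℂ` says that the elements of `H` are functions `𝔻 → ℂ` and that all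
point evaluations are continuous on `H`. -/

section Admissible

variable (H : Type*) [NormedAddCommGroup H] [InnerProductSpace ℂ H] [RKHS ℂ H 𝔻 ℂ]

/-- The composition operator `f ↦ f ∘ φ` maps `H` into `H` and is bounded. -/
def CompositionBounded (φ : 𝔻 → 𝔻) : Prop :=
  ∃ C : H →L[ℂ] H, ∀ (f : H) (z : 𝔻), C f z = f (φ z)

/-- All automorphisms of the disc induce bounded composition operators on `H`. -/
def AutomorphismsBounded : Prop :=
  ∀ φ : 𝔻 → 𝔻, IsDiscAutomorphism φ → CompositionBounded H φ

/-- The set of multipliers of `H`: the `w ∈ H` such that `w f ∈ H` for every `f ∈ H`. -/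
def multipliers : Set (𝔻 → ℂ) :=
  {w | (∃ u : H, ⇑u = w) ∧ ∀ f : H, ∃ g : H, ∀ z : 𝔻, g z = w z * f z}

/-- The reproducing kernel `K_a` of `H`, characterized by `⟪K_a, f⟫ = f a`
(the inner product being conjugate-linear in the first variable). -/
def kernelAt [CompleteSpace H] (a : 𝔻) : H :=
  RKHS.kerFun H a (1 : ℂ)

/-- An admissible Hilbert space of analytic functions on the disc. -/
structure IsAdmissible [CompleteSpace H] : Prop where
  /-- The elements of `H` are analytic functions. -/
  analytic : ∀ f : H, IsAnalytic (⇑f)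
  /-- `H` contains the constants. -/
  constants : ∀ c : ℂ, ∃ f : H, ∀ z : 𝔻, f z = c
  /-- `H²` is continuously embedded in `H`. -/
  hardy_embedded : ∃ C : ℝ, ∀ g ∈ hardySpace, ∃ f : H, ⇑f = g ∧ ‖f‖ ≤ C * hardyNorm g
  /-- The multipliers of `H` are exactly the bounded analytic functions. -/
  multipliers_eq : multipliers H = hInfty
  /-- The automorphisms of the disc induce bounded composition operators. -/
  automorphisms : AutomorphismsBounded H
  /-- Control of the quotients of the norms of the kernels near the boundary. -/
  kernel_ratio : ∃ h : ℝ → ℝ, MonotoneOn h (Set.Ici 0) ∧ (∀ t, 0 ≤ t → 0 ≤ h t) ∧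
    ∃ r : ℝ, r < 1 ∧ ∀ a b : 𝔻, r < ‖(a : ℂ)‖ → r < ‖(b : ℂ)‖ →
      ‖kernelAt H a‖ / ‖kernelAt H b‖ ≤ h ((1 - ‖(b : ℂ)‖) / (1 - ‖(a : ℂ)‖))

end Admissible

/-! ### The weighted Hardy space `H²(β)` -/

/-- A weight sequence: positive numbers `β_k` with `liminf β_k ^ (1 / k) ≥ 1`. The lower limit is
taken in `[0, ∞]`, so that unbounded sequences are treated correctly. -/
structure Weight where
  /-- The terms of the sequence. -/
  toFun : ℕ → ℝ
  pos : ∀ k, 0 < toFun k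
  one_le_liminf :
    1 ≤ Filter.liminf (fun k : ℕ => ENNReal.ofReal (toFun k ^ (1 / (k : ℝ)))) Filter.atTop

instance : CoeFun Weight (fun _ => ℕ → ℝ) := ⟨Weight.toFun⟩

/-- The space `H²(β)`: its elements are the power series `∑ c_k z^k` with
`∑ β_k |c_k|² < ∞`. -/
@[ext]
structure WeightedHardy (β : Weight) where
  /-- The Taylor coefficients. -/
  coeff : ℕ → ℂ
  summable : Summable fun k => β k * ‖coeff k‖ ^ 2

namespace WeightedHardy

variable {β : Weight}

theorem coeff_injective : Function.Injective (coeff : WeightedHardy β → ℕ → ℂ) :=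
  fun _ _ h => WeightedHardy.ext h

theorem summable_add {c d : ℕ → ℂ} (hc : Summable fun k => β k * ‖c k‖ ^ 2)
    (hd : Summable fun k => β k * ‖d k‖ ^ 2) : Summable fun k => β k * ‖c k + d k‖ ^ 2 := by
  refine Summable.of_nonneg_of_le (fun k => ?_) (fun k => ?_) ((hc.add hd).mul_left 2)
  · exact mul_nonneg (β.pos k).le (sq_nonneg _)
  · have h1 : ‖c k + d k‖ ^ 2 ≤ 2 * (‖c k‖ ^ 2 + ‖d k‖ ^ 2) := by
      have := norm_add_le (c k) (d k)
      nlinarith [sq_nonneg (‖c k‖ - ‖d k‖), norm_nonneg (c k + d k)]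
    nlinarith [mul_le_mul_of_nonneg_left h1 (β.pos k).le]

theorem summable_smul {R : Type*} [SeminormedRing R] [Module R ℂ] [NormSMulClass R ℂ] (a : R)
    {c : ℕ → ℂ} (hc : Summable fun k => β k * ‖c k‖ ^ 2) :
    Summable fun k => β k * ‖a • c k‖ ^ 2 := by
  refine (hc.mul_left (‖a‖ ^ 2)).congr fun k => ?_
  rw [norm_smul]; ring

theorem summable_neg {c : ℕ → ℂ} (hc : Summable fun k => β k * ‖c k‖ ^ 2) :
    Summable fun k => β k * ‖-c k‖ ^ 2 := by
  simpa using hc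

instance : Zero (WeightedHardy β) := ⟨⟨0, by simp⟩⟩
instance : Add (WeightedHardy β) := ⟨fun f g => ⟨f.coeff + g.coeff, summable_add f.2 g.2⟩⟩
instance : Neg (WeightedHardy β) := ⟨fun f => ⟨-f.coeff, summable_neg f.2⟩⟩
instance : Sub (WeightedHardy β) := ⟨fun f g => ⟨f.coeff - g.coeff, by
  simpa [sub_eq_add_neg] using summable_add f.2 (summable_neg g.2)⟩⟩
instance : SMul ℂ (WeightedHardy β) := ⟨fun a f => ⟨a • f.coeff, summable_smul a f.2⟩⟩
instance : SMul ℕ (WeightedHardy β) := ⟨fun n f => ⟨n • f.coeff, by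
  simpa using summable_smul (n : ℂ) f.2⟩⟩
instance : SMul ℤ (WeightedHardy β) := ⟨fun n f => ⟨n • f.coeff, by
  simpa using summable_smul (n : ℂ) f.2⟩⟩

instance : AddCommGroup (WeightedHardy β) :=
  coeff_injective.addCommGroup coeff rfl (fun _ _ => rfl) (fun _ => rfl) (fun _ _ => rfl)
    (fun _ _ => rfl) (fun _ _ => rfl)

/-- Taylor coefficients as an additive map. -/
def coeffHom : WeightedHardy β →+ (ℕ → ℂ) where
  toFun := coeff
  map_zero' := rfl
  map_add' _ _ := rfl

instance : Module ℂ (WeightedHardy β) :=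
  coeff_injective.module ℂ coeffHom (fun _ _ => rfl)

@[simp] theorem coeff_add (f g : WeightedHardy β) (k : ℕ) :
    (f + g).coeff k = f.coeff k + g.coeff k := rfl
@[simp] theorem coeff_smul (a : ℂ) (f : WeightedHardy β) (k : ℕ) :
    (a • f).coeff k = a * f.coeff k := rfl
@[simp] theorem coeff_zero (k : ℕ) : (0 : WeightedHardy β).coeff k = 0 := rfl
@[simp] theorem coeff_sub (f g : WeightedHardy β) (k : ℕ) :
    (f - g).coeff k = f.coeff k - g.coeff k := rfl

theorem summable_inner (f g : WeightedHardy β) :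
    Summable fun k => (β k : ℂ) * (starRingEnd ℂ (f.coeff k) * g.coeff k) := by
  refine Summable.of_norm_bounded (f.2.add g.2) fun k => ?_
  rw [norm_mul, norm_mul, RCLike.norm_conj, Complex.norm_real, Real.norm_of_nonneg (β.pos k).le,
    ← mul_add]
  refine mul_le_mul_of_nonneg_left ?_ (β.pos k).le
  nlinarith [sq_nonneg (‖f.coeff k‖ - ‖g.coeff k‖), sq_nonneg ‖f.coeff k‖, sq_nonneg ‖g.coeff k‖]

theorem inner_term_self (c : ℂ) (b : ℝ) :
    (b : ℂ) * (starRingEnd ℂ c * c) = ((b * ‖c‖ ^ 2 : ℝ) : ℂ) := by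
  rw [Complex.conj_mul']; push_cast; ring

/-- The inner product `∑ β_k conj(c_k) d_k` of `H²(β)`. -/
@[reducible] def core : InnerProductSpace.Core ℂ (WeightedHardy β) where
  inner f g := ∑' k, (β k : ℂ) * (starRingEnd ℂ (f.coeff k) * g.coeff k)
  conj_inner_symm f g := by
    rw [Complex.conj_tsum]
    refine tsum_congr fun k => ?_
    simp only [map_mul, Complex.conj_ofReal, Complex.conj_conj]
    ring
  re_inner_nonneg f := by
    simp only [inner_term_self]
    rw [← Complex.ofReal_tsum]
    exact tsum_nonneg fun k => mul_nonneg (β.pos k).le (sq_nonneg _)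
  add_left f g h := by
    rw [← (summable_inner f h).tsum_add (summable_inner g h)]
    refine tsum_congr fun k => ?_
    simp only [coeff_add, map_add]
    ring
  smul_left f g a := by
    rw [← tsum_mul_left]
    refine tsum_congr fun k => ?_
    simp only [coeff_smul, map_mul]
    ring
  definite f hf := by
    simp only [inner_term_self] at hf
    rw [← Complex.ofReal_tsum, Complex.ofReal_eq_zero] at hf
    have h0 := (hasSum_zero_iff_of_nonneg
      (fun k => mul_nonneg (β.pos k).le (sq_nonneg ‖f.coeff k‖))).1 (hf ▸ f.2.hasSum)
    ext k
    have := congrFun h0 k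
    simpa [(β.pos k).ne'] using this

instance : NormedAddCommGroup (WeightedHardy β) :=
  core.toNormedAddCommGroup

instance : InnerProductSpace ℂ (WeightedHardy β) :=
  .ofCore core.toCore

theorem inner_def (f g : WeightedHardy β) :
    ⟪f, g⟫_ℂ = ∑' k, (β k : ℂ) * (starRingEnd ℂ (f.coeff k) * g.coeff k) := rfl

/-- The norm of `H²(β)` is the expected one. -/
theorem norm_sq (f : WeightedHardy β) : ‖f‖ ^ 2 = ∑' k, β k * ‖f.coeff k‖ ^ 2 := by
  have h := inner_self_eq_norm_sq_to_K (𝕜 := ℂ) f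
  rw [inner_def] at h
  simp only [inner_term_self] at h
  rw [← Complex.ofReal_tsum] at h
  refine Complex.ofReal_injective (Eq.trans ?_ h.symm)
  push_cast
  rfl

/-- The isometry `c ↦ (√β_k c_k)` onto `ℓ²`. -/
def toL2 : WeightedHardy β →ₗᵢ[ℂ] lp (fun _ : ℕ => ℂ) 2 where
  toFun f := ⟨fun k => (√(β k) : ℂ) * f.coeff k, by
    refine memℓp_gen (f.2.congr fun k => ?_)
    simp [mul_pow, abs_of_nonneg (Real.sqrt_nonneg _), Real.sq_sqrt (β.pos k).le]⟩
  map_add' f g := by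
    ext k
    exact mul_add _ _ _
  map_smul' a f := by ext k; simp; ring
  norm_map' f := by
    rw [← sq_eq_sq₀ (norm_nonneg _) (norm_nonneg _), norm_sq]
    have := lp.norm_rpow_eq_tsum (p := 2) (by norm_num) (E := fun _ : ℕ => ℂ)
      ⟨fun k => (√(β k) : ℂ) * f.coeff k, by
        refine memℓp_gen (f.2.congr fun k => ?_)
        simp [mul_pow, abs_of_nonneg (Real.sqrt_nonneg _), Real.sq_sqrt (β.pos k).le]⟩
    simp only [ENNReal.toReal_ofNat, Real.rpow_ofNat] at this
    refine this.trans (tsum_congr fun k => ?_)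
    simp [mul_pow, abs_of_nonneg (Real.sqrt_nonneg _), Real.sq_sqrt (β.pos k).le]

theorem toL2_surjective : Function.Surjective (toL2 : WeightedHardy β → _) := by
  intro a
  have ha := (lp.memℓp a).summable (by norm_num : 0 < (2 : ENNReal).toReal)
  have hs : ∀ k, √(β k) ≠ 0 := fun k => (Real.sqrt_pos.2 (β.pos k)).ne'
  refine ⟨⟨fun k => a k / (√(β k) : ℂ), ha.congr fun k => ?_⟩, ?_⟩
  · simp only [ENNReal.toReal_ofNat, Real.rpow_ofNat, norm_div, Complex.norm_real,
      Real.norm_of_nonneg (Real.sqrt_nonneg _), div_pow, Real.sq_sqrt (β.pos k).le]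
    field_simp [(β.pos k).ne']
  · ext k
    have : (√(β k) : ℂ) ≠ 0 := by exact_mod_cast hs k
    change (√(β k) : ℂ) * (a k / (√(β k) : ℂ)) = a k
    field_simp

instance : CompleteSpace (WeightedHardy β) :=
  ((LinearIsometryEquiv.ofSurjective toL2 toL2_surjective).toIsometryEquiv.completeSpace_iff).2
    inferInstance

theorem summable_kernel (z : 𝔻) : Summable fun k => ‖(z : ℂ)‖ ^ (2 * k) / β k := by
  obtain ⟨s, hs1, hs2⟩ := exists_between z.sq_norm_lt_one
  have hs0 : 0 < s := (sq_nonneg _).trans_lt hs1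
  have hev : ∀ᶠ k : ℕ in Filter.atTop, s ^ k < β k := by
    have h : ENNReal.ofReal s < Filter.liminf
        (fun k : ℕ => ENNReal.ofReal (β k ^ (1 / (k : ℝ)))) Filter.atTop :=
      lt_of_lt_of_le (by simpa using hs2) β.one_le_liminf
    filter_upwards [Filter.eventually_lt_of_lt_liminf h, Filter.eventually_gt_atTop 0]
      with k hk hk0
    have h1 := (ENNReal.ofReal_lt_ofReal_iff_of_nonneg hs0.le).1 hk
    have h2 := pow_lt_pow_left₀ h1 hs0.le hk0.ne'
    rwa [one_div, Real.rpow_inv_natCast_pow (β.pos k).le hk0.ne'] at h2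
  have hg : Summable fun k : ℕ => (‖(z : ℂ)‖ ^ 2 / s) ^ k :=
    summable_geometric_of_lt_one (by positivity) ((div_lt_one hs0).2 hs1)
  refine Summable.of_norm_bounded_eventually_nat hg ?_
  filter_upwards [hev] with k hk
  rw [Real.norm_of_nonneg (div_nonneg (by positivity) (β.pos k).le), div_pow, ← pow_mul]
  exact div_le_div_of_nonneg_left (by positivity) (by positivity) hk.le

/-- The kernel of the evaluation at `z`: its Taylor coefficients are `conj(z)^k / β_k`. -/
def evalKernel (β : Weight) (z : 𝔻) : WeightedHardy β where
  coeff k := starRingEnd ℂ (z : ℂ) ^ k / (β k : ℂ)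
  summable := (summable_kernel z).congr fun k => by
    have := (β.pos k).ne'
    simp only [norm_div, norm_pow, RCLike.norm_conj, Complex.norm_real,
      Real.norm_of_nonneg (β.pos k).le]
    field_simp
    ring

theorem inner_term_evalKernel (z : 𝔻) (f : WeightedHardy β) (k : ℕ) :
    (β k : ℂ) * (starRingEnd ℂ ((evalKernel β z).coeff k) * f.coeff k)
      = f.coeff k * (z : ℂ) ^ k := by
  have : (β k : ℂ) ≠ 0 := by exact_mod_cast (β.pos k).ne'
  simp only [evalKernel, map_div₀, map_pow, Complex.conj_conj, Complex.conj_ofReal]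
  field_simp

theorem summable_eval (f : WeightedHardy β) (z : 𝔻) :
    Summable fun k => f.coeff k * (z : ℂ) ^ k :=
  (summable_inner (evalKernel β z) f).congr fun k => inner_term_evalKernel z f k

theorem inner_evalKernel (f : WeightedHardy β) (z : 𝔻) :
    ⟪evalKernel β z, f⟫_ℂ = ∑' k, f.coeff k * (z : ℂ) ^ k :=
  tsum_congr fun k => inner_term_evalKernel z f k

theorem coeff_eq_zero_of_eval (f : WeightedHardy β)
    (h : ∀ z : 𝔻, ∑' k, f.coeff k * (z : ℂ) ^ k = 0) : f = 0 := by
  have hp : HasFPowerSeriesAt (fun _ : ℂ => (0 : ℂ))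
      (FormalMultilinearSeries.ofScalars ℂ f.coeff) 0 := by
    rw [hasFPowerSeriesAt_iff]
    filter_upwards [Metric.ball_mem_nhds (0 : ℂ) one_pos] with z hz
    have hz' : ‖z‖ < 1 := by simpa using hz
    have h1 := (summable_eval f (Complex.UnitDisc.mk z hz')).hasSum
    rw [h] at h1
    simpa [FormalMultilinearSeries.coeff_ofScalars, mul_comm] using h1
  ext k
  have := hp.eq_zero
  have h2 : (FormalMultilinearSeries.ofScalars ℂ f.coeff).coeff k = 0 := by rw [this]; rfl
  simpa [FormalMultilinearSeries.coeff_ofScalars] using h2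

/-- An element of `H²(β)` with Taylor coefficients `c_k` is the function `z ↦ ∑ c_k z^k`. -/
instance : RKHS ℂ (WeightedHardy β) 𝔻 ℂ where
  coeCLM :=
    { toFun := fun f z => ∑' k, f.coeff k * (z : ℂ) ^ k
      map_add' := fun f g => by
        funext z
        simp only [Pi.add_apply, ← inner_evalKernel, inner_add_right]
      map_smul' := fun a f => by
        funext z
        simp only [Pi.smul_apply, ← inner_evalKernel, inner_smul_right, RingHom.id_apply,
          smul_eq_mul]
      cont := continuous_pi fun z => by
        simp only [← inner_evalKernel]
        exact continuous_const.inner continuous_id }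
  coeCLM_injective := by
    refine (injective_iff_map_eq_zero _).2 fun f hf => ?_
    exact coeff_eq_zero_of_eval f fun z => congrFun hf z

theorem apply_eq (f : WeightedHardy β) (z : 𝔻) : f z = ∑' k, f.coeff k * (z : ℂ) ^ k := rfl

end WeightedHardy

end DiscSpaces

end

/-! Everything rests on two facts: Parseval's formula with remainder on circles, and the formula
`‖K_a‖² = ∑ |a|^(2k) / β_k`, which makes kernel norms radial and increasing in `|a|`.

Multiplication by `w ∈ H^∞` is lower triangular on Taylor coefficients: the first `n` coefficients
of `w f` depend only on the first `n` of `f`. Truncating `f` to a polynomial therefore gives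
`∑_{k<n} |(wf)_k|² ≤ ‖w‖_∞² ∑_{k<n} |f_k|²` for every `n` (`sum_normSq_cauchyProd_le`). Since all
partial sums are compared, summation by parts inserts the decreasing weight `β` and yields `‖w f‖ ≤
‖w‖_∞ ‖f‖` (`exists_mul`). Conversely, testing a multiplication operator on `K_z` gives `|w z| ≤
‖M_w‖` (`norm_le_opNorm_of_mul`), so multipliers are bounded and the norms agree. The embedding of
`H²` only needs `β_k ≤ β_0`.

For the kernel quotients a single automorphism suffices, `z ↦ (z + 1/2) / (1 + z/2)`. On `[0, 1)` it
at least halves the distance to the boundary, while the kernel norm grows at most by the norm of the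
composition operator. Iterating from `|b|` until `|a|` is passed takes a number of steps controlled
by `(1 - |b|) / (1 - |a|)` (`norm_kernelAt_iterate_le`). -/

noncomputable section

namespace DiscSpaces

open Metric Real

/-! ### Power series on the disc -/

/-- The power series with coefficients `c` converges (absolutely) on the open unit disc. -/
def ConvergesOnDisc (c : ℕ → ℂ) : Prop :=
  ∀ r : ℝ, 0 ≤ r → r < 1 → Summable fun k => ‖c k‖ * r ^ k

/-- The sum of the power series with coefficients `c`. -/
def powerSum (c : ℕ → ℂ) (z : ℂ) : ℂ := ∑' k, c k * z ^ k

theorem extend_coe (f : 𝔻 → ℂ) (z : 𝔻) : extend f z = f z := by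
  simp [extend, z.norm_lt_one]

namespace ConvergesOnDisc

variable {c d : ℕ → ℂ}

theorem of_summable (h : ∀ r : ℝ, 0 ≤ r → r < 1 → Summable fun k => c k * (r : ℂ) ^ k) :
    ConvergesOnDisc c := fun r h0 h1 => by
  simpa [abs_of_nonneg h0] using (h r h0 h1).norm

theorem summable_norm (hc : ConvergesOnDisc c) {z : ℂ} (hz : ‖z‖ < 1) :
    Summable fun k => ‖c k * z ^ k‖ := by
  simpa using hc ‖z‖ (norm_nonneg _) hz

theorem summable (hc : ConvergesOnDisc c) {z : ℂ} (hz : ‖z‖ < 1) :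
    Summable fun k => c k * z ^ k := (hc.summable_norm hz).of_norm

theorem analyticOnNhd (hc : ConvergesOnDisc c) :
    AnalyticOnNhd ℂ (powerSum c) (ball 0 1) := by
  have h : HasFPowerSeriesOnBall (powerSum c) (FormalMultilinearSeries.ofScalars ℂ c) 0 1 := by
    refine ⟨ENNReal.le_of_forall_nnreal_lt fun r hr => ?_, one_pos, fun {y} hy => ?_⟩
    · refine FormalMultilinearSeries.le_radius_of_summable _ ?_
      have := hc r r.2 (by exact_mod_cast hr)
      simpa [FormalMultilinearSeries.ofScalars_norm] using this
    · have hy' : ‖y‖ < 1 := by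
        rwa [← ENNReal.ofReal_one, eball_ofReal, mem_ball_zero_iff] at hy
      simpa [FormalMultilinearSeries.ofScalars_apply_eq, powerSum, smul_eq_mul, mul_comm] using
        (hc.summable hy').hasSum
  have := h.analyticOnNhd
  rwa [← ENNReal.ofReal_one, eball_ofReal] at this

theorem differentiableAt (hc : ConvergesOnDisc c) {z : ℂ} (hz : ‖z‖ < 1) :
    DifferentiableAt ℂ (powerSum c) z :=
  (hc.analyticOnNhd z (by simpa using hz)).differentiableAt

theorem isAnalytic (hc : ConvergesOnDisc c) {f : 𝔻 → ℂ} (hf : ∀ z : 𝔻, f z = powerSum c z) :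
    IsAnalytic f := by
  refine hc.analyticOnNhd.congr isOpen_ball fun z hz => ?_
  have hz' : ‖z‖ < 1 := by simpa using hz
  simp [extend, hz', hf]

theorem shift (hc : ConvergesOnDisc c) : ConvergesOnDisc fun k => c (k + 1) := by
  intro r h0 h1
  -- The shifted series is the tail of the original one divided by `r`, so `r = 0` is treated apart.
  rcases h0.eq_or_lt with rfl | h0
  · exact summable_of_ne_finset_zero (s := {0}) fun k hk => by
      rw [zero_pow (by simpa using hk), mul_zero]
  · have := (summable_nat_add_iff 1).2 (hc r h0.le h1)
    refine (this.mul_right r⁻¹).congr fun k => ?_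
    field_simp
    ring

theorem powerSum_eq (hc : ConvergesOnDisc c) {z : ℂ} (hz : ‖z‖ < 1) :
    powerSum c z = c 0 + z * powerSum (fun k => c (k + 1)) z := by
  rw [powerSum, (hc.summable hz).tsum_eq_zero_add, powerSum, ← tsum_mul_left]
  simp only [pow_zero, mul_one]
  congr 1
  exact tsum_congr fun k => by ring

end ConvergesOnDisc

theorem IsAnalytic.exists_powerSum {f : 𝔻 → ℂ} (hf : IsAnalytic f) :
    ∃ c, ConvergesOnDisc c ∧ ∀ z : 𝔻, f z = powerSum c z := by
  have key : ∀ z : ℂ, ‖z‖ < 1 → HasSum (fun k : ℕ =>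
      ((k.factorial : ℂ)⁻¹ * iteratedDeriv k (extend f) 0) * z ^ k) (extend f z) := by
    intro z hz
    have := Complex.hasSum_taylorSeries_on_ball (r := 1) hf.differentiableOn
      (show z ∈ ball (0 : ℂ) 1 by simpa using hz)
    refine (Eq.subst (motive := fun u => HasSum u (extend f z)) (funext fun k => ?_) this)
    simp only [sub_zero, smul_eq_mul]
    ring
  refine ⟨_, ConvergesOnDisc.of_summable fun r h0 h1 =>
    (key r (by simpa [abs_of_nonneg h0] using h1)).summable, fun z => ?_⟩
  rw [← extend_coe f z]
  exact (key z z.norm_lt_one).tsum_eq.symm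

/-! ### Means over circles -/

theorem circleIntegrable_normSq_powerSum {c : ℕ → ℂ} (hc : ConvergesOnDisc c) {r : ℝ}
    (h0 : 0 ≤ r) (h1 : r < 1) : CircleIntegrable (fun z => ‖powerSum c z‖ ^ 2) 0 r := by
  refine ContinuousOn.circleIntegrable h0 fun z hz => ?_
  have hz' : ‖z‖ < 1 := by
    have : ‖z‖ = r := by simpa using hz
    linarith
  exact ((hc.differentiableAt hz').continuousAt.norm.pow 2).continuousWithinAt

/-- Write the series as `c 0 + z q(z)` and expand the square. The cross term is the real part of `2
conj(c 0) z q(z)`, which is analytic and vanishes at `0`, so its circle mean is zero. -/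
theorem circleAverage_normSq_step {c : ℕ → ℂ} (hc : ConvergesOnDisc c) {r : ℝ}
    (h0 : 0 < r) (h1 : r < 1) :
    circleAverage (fun z => ‖powerSum c z‖ ^ 2) 0 r =
      ‖c 0‖ ^ 2 + r ^ 2 * circleAverage (fun z => ‖powerSum (fun k => c (k + 1)) z‖ ^ 2) 0 r := by
  set q := powerSum fun k => c (k + 1) with hq
  have hsph : ∀ z ∈ sphere (0 : ℂ) |r|, ‖z‖ = r := fun z hz => by
    simpa [abs_of_pos h0] using hz
  set g : ℂ → ℂ := fun z => (2 * starRingEnd ℂ (c 0)) * (z * q z) with hg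
  have hgd : ∀ z : ℂ, ‖z‖ < 1 → DifferentiableAt ℂ g z := fun z hz =>
    (differentiableAt_id.mul (hc.shift.differentiableAt hz)).const_mul _
  have hball : closedBall (0 : ℂ) |r| ⊆ {z | ‖z‖ < 1} := fun z hz => by
    have : ‖z‖ ≤ r := by simpa [abs_of_pos h0] using hz
    exact this.trans_lt h1
  have hmean : circleAverage g 0 r = 0 := by
    rw [circleAverage_of_differentiable_on_off_countable Set.countable_empty
      (fun z hz => (hgd z (hball hz)).continuousAt.continuousWithinAt)
      (fun z hz => hgd z (hball (ball_subset_closedBall hz.1)))]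
    simp [hg]
  have hgi : CircleIntegrable g 0 r := by
    refine ContinuousOn.circleIntegrable' fun z hz => ?_
    exact (hgd z ((hsph z hz).trans_lt h1)).continuousAt.continuousWithinAt
  have hre : circleAverage (fun z => (g z).re) 0 r = 0 := by
    have := Complex.reCLM.circleAverage_comp_comm hgi
    simpa [hmean, Function.comp_def] using this
  have hrei : CircleIntegrable (fun z => (g z).re) 0 r := by
    refine ContinuousOn.circleIntegrable' fun z hz => ?_
    exact (Complex.continuous_re.continuousAt.comp
      (hgd z ((hsph z hz).trans_lt h1)).continuousAt).continuousWithinAt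
  have hqi := circleIntegrable_normSq_powerSum hc.shift h0.le h1
  have hcongr : Set.EqOn (fun z => ‖powerSum c z‖ ^ 2)
      (fun z => (‖c 0‖ ^ 2 + (g z).re) + r ^ 2 * ‖q z‖ ^ 2) (sphere 0 |r|) := by
    intro z hz
    have hz1 := hsph z hz
    simp only
    rw [hc.powerSum_eq (hz1.trans_lt h1), ← hq, ← hz1, ← mul_pow, ← norm_mul, hg]
    simp only [← Complex.normSq_eq_norm_sq, Complex.normSq_apply, Complex.add_re, Complex.add_im,
      Complex.mul_re, Complex.conj_re, Complex.conj_im, Complex.mul_im, Complex.re_ofNat,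
      Complex.im_ofNat]
    ring
  have hqi' : CircleIntegrable (fun z => r ^ 2 • ‖q z‖ ^ 2) 0 r := hqi.const_mul _
  have hci : CircleIntegrable (fun _ => ‖c 0‖ ^ 2) 0 r := circleIntegrable_const _ _ _
  rw [circleAverage_congr_sphere hcongr]
  have h₁ := circleAverage_fun_add (hci.add hrei) hqi'
  have h₂ := circleAverage_fun_add hci hrei
  rw [circleAverage_fun_smul] at h₁
  rw [hre, circleAverage_const, add_zero] at h₂
  exact h₁.trans (congrArg (· + _) h₂)

/-- Parseval with an exact remainder, obtained by peeling off one coefficient at a time, without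
interchanging sum and integral. Dropping the remainder gives Bessel's inequality; for a polynomial
of degree below `n` the remainder vanishes. -/
theorem circleAverage_normSq_eq (n : ℕ) : ∀ {c : ℕ → ℂ}, ConvergesOnDisc c → ∀ {r : ℝ},
    0 < r → r < 1 → circleAverage (fun z => ‖powerSum c z‖ ^ 2) 0 r =
      ∑ k ∈ Finset.range n, ‖c k‖ ^ 2 * (r ^ 2) ^ k +
      (r ^ 2) ^ n * circleAverage (fun z => ‖powerSum (fun k => c (k + n)) z‖ ^ 2) 0 r := by
  induction n with
  | zero => intro c hc r h0 h1; simp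
  | succ n ih =>
    intro c hc r h0 h1
    rw [circleAverage_normSq_step hc h0 h1, ih hc.shift h0 h1, Finset.sum_range_succ']
    have h : ∀ k, k + n + 1 = k + (n + 1) := fun k => by ring
    simp only [mul_add, Finset.mul_sum, h]
    rw [Finset.sum_congr rfl fun k _ => show r ^ 2 * (‖c (k + 1)‖ ^ 2 * (r ^ 2) ^ k) =
      ‖c (k + 1)‖ ^ 2 * (r ^ 2) ^ (k + 1) by ring]
    ring

theorem circleAverage_normSq_nonneg (c : ℕ → ℂ) (r : ℝ) :
    0 ≤ circleAverage (fun z => ‖powerSum c z‖ ^ 2) 0 r :=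
  circleAverage_nonneg_of_nonneg fun _ _ => sq_nonneg _

/-- Bessel's inequality on the circle of radius `r`. -/
theorem sum_normSq_le_circleAverage {c : ℕ → ℂ} (hc : ConvergesOnDisc c) {r : ℝ}
    (h0 : 0 < r) (h1 : r < 1) (n : ℕ) :
    ∑ k ∈ Finset.range n, ‖c k‖ ^ 2 * (r ^ 2) ^ k ≤
      circleAverage (fun z => ‖powerSum c z‖ ^ 2) 0 r := by
  rw [circleAverage_normSq_eq n hc h0 h1]
  have := circleAverage_normSq_nonneg (fun k => c (k + n)) r
  have : 0 ≤ (r ^ 2) ^ n * circleAverage (fun z => ‖powerSum (fun k => c (k + n)) z‖ ^ 2) 0 r := by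
    positivity
  linarith

/-- The inequality `∑ |c_k|² ≤ A`, if `∑ |c_k|² r^{2k} ≤ A` for all `r < 1`. -/
theorem sum_normSq_le_of_forall_lt {c : ℕ → ℂ} {n : ℕ} {A : ℝ}
    (h : ∀ r : ℝ, 0 < r → r < 1 → ∑ k ∈ Finset.range n, ‖c k‖ ^ 2 * (r ^ 2) ^ k ≤ A) :
    ∑ k ∈ Finset.range n, ‖c k‖ ^ 2 ≤ A := by
  have hcont : Continuous fun r : ℝ => ∑ k ∈ Finset.range n, ‖c k‖ ^ 2 * (r ^ 2) ^ k := by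
    fun_prop
  have ht := (hcont.tendsto 1).mono_left (nhdsWithin_le_nhds (s := Set.Iio 1))
  simp only [one_pow, mul_one] at ht
  refine le_of_tendsto ht ?_
  filter_upwards [Ioo_mem_nhdsLT (zero_lt_one' ℝ)] with r hr using h r hr.1 hr.2

/-! ### Products -/

/-- The coefficients of the Cauchy product. -/
def cauchyProd (a b : ℕ → ℂ) (n : ℕ) : ℂ := ∑ p ∈ Finset.HasAntidiagonal.antidiagonal n, a p.1 * b p.2

theorem cauchyProd_mul_pow (a b : ℕ → ℂ) (z : ℂ) (n : ℕ) :
    cauchyProd a b n * z ^ n =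
      ∑ p ∈ Finset.HasAntidiagonal.antidiagonal n, (a p.1 * z ^ p.1) * (b p.2 * z ^ p.2) := by
  rw [cauchyProd, Finset.sum_mul]
  refine Finset.sum_congr rfl fun p hp => ?_
  rw [← Finset.HasAntidiagonal.mem_antidiagonal.1 hp]
  ring

theorem ConvergesOnDisc.cauchyProd {a b : ℕ → ℂ} (ha : ConvergesOnDisc a)
    (hb : ConvergesOnDisc b) : ConvergesOnDisc (cauchyProd a b) := by
  refine of_summable fun r h0 h1 => ?_
  have hr : ‖(r : ℂ)‖ < 1 := by simpa [abs_of_nonneg h0] using h1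
  simp only [cauchyProd_mul_pow]
  exact (summable_norm_sum_mul_antidiagonal_of_summable_norm (ha.summable_norm hr)
    (hb.summable_norm hr)).of_norm

theorem powerSum_cauchyProd {a b : ℕ → ℂ} (ha : ConvergesOnDisc a) (hb : ConvergesOnDisc b)
    {z : ℂ} (hz : ‖z‖ < 1) : powerSum (cauchyProd a b) z = powerSum a z * powerSum b z := by
  simp only [powerSum, cauchyProd_mul_pow]
  exact (tsum_mul_tsum_eq_tsum_sum_antidiagonal_of_summable_norm (ha.summable_norm hz)
    (hb.summable_norm hz)).symm

/-- Coefficients of index at least `n` of `f` do not enter the left side, so `f` may be cut to a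
polynomial `p`. On a circle of radius `r < 1`, Bessel for `w p`, the bound `|w p| ≤ B |p|` and exact
Parseval for `p` combine; then `r → 1`. No convergence of `f` is needed. -/
theorem sum_normSq_cauchyProd_le {w : ℕ → ℂ} (hw : ConvergesOnDisc w) {B : ℝ}
    (hB : ∀ z : ℂ, ‖z‖ < 1 → ‖powerSum w z‖ ≤ B) (f : ℕ → ℂ) (n : ℕ) :
    ∑ k ∈ Finset.range n, ‖cauchyProd w f k‖ ^ 2 ≤ B ^ 2 * ∑ k ∈ Finset.range n, ‖f k‖ ^ 2 := by
  set p : ℕ → ℂ := fun k => if k < n then f k else 0 with hp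
  have hpc : ConvergesOnDisc p := fun r _ _ =>
    summable_of_ne_finset_zero (s := Finset.range n) fun k hk => by
      have : ¬ k < n := by simpa using hk
      simp [hp, this]
  have hprod : ∀ k ∈ Finset.range n, cauchyProd w f k = cauchyProd w p k := by
    intro k hk
    refine Finset.sum_congr rfl fun x hx => ?_
    have h1 := Finset.HasAntidiagonal.mem_antidiagonal.1 hx
    have h2 := Finset.mem_range.1 hk
    have : x.2 < n := by omega
    simp [hp, this]
  rw [Finset.sum_congr rfl fun k hk => congrArg (fun x => ‖x‖ ^ 2) (hprod k hk)]
  refine sum_normSq_le_of_forall_lt fun r h0 h1 => ?_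
  have hB0 : 0 ≤ B := (norm_nonneg _).trans (hB 0 (by simp))
  refine (sum_normSq_le_circleAverage (hw.cauchyProd hpc) h0 h1 n).trans ?_
  -- This kills the Parseval remainder of `p` after `n` terms.
  have htail : (fun k => p (k + n)) = 0 := by
    funext k; simp [hp]
  calc circleAverage (fun z => ‖powerSum (cauchyProd w p) z‖ ^ 2) 0 r
      ≤ circleAverage (fun z => B ^ 2 • ‖powerSum p z‖ ^ 2) 0 r := by
        refine circleAverage_mono (circleIntegrable_normSq_powerSum (hw.cauchyProd hpc) h0.le h1)
          ((circleIntegrable_normSq_powerSum hpc h0.le h1).const_mul _) fun z hz => ?_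
        have hz1 : ‖z‖ < 1 := by
          have : ‖z‖ = r := by simpa [abs_of_pos h0] using hz
          linarith
        rw [powerSum_cauchyProd hw hpc hz1, norm_mul, mul_pow, smul_eq_mul]
        gcongr
        exact hB z hz1
    _ = B ^ 2 * circleAverage (fun z => ‖powerSum p z‖ ^ 2) 0 r := circleAverage_fun_smul
    _ ≤ B ^ 2 * ∑ k ∈ Finset.range n, ‖f k‖ ^ 2 := by
        rw [circleAverage_normSq_eq n hpc h0 h1, htail]
        refine mul_le_mul_of_nonneg_left ?_ (sq_nonneg _)
        simp only [powerSum, Pi.zero_apply, zero_mul, tsum_zero, norm_zero, ne_eq,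
          OfNat.ofNat_ne_zero, not_false_eq_true, zero_pow, circleAverage_const, mul_zero,
          add_zero]
        refine Finset.sum_le_sum fun k hk => ?_
        have hk' := Finset.mem_range.1 hk
        simp only [hp, hk', if_true]
        refine mul_le_of_le_one_right (sq_nonneg _) (pow_le_one₀ (sq_nonneg _) ?_)
        exact pow_le_one₀ h0.le h1.le

/-- Summation by parts against a decreasing weight. -/
theorem mul_sum_le_sum_mul {β u : ℕ → ℝ} (hβ : Antitone β)
    (hu : ∀ n, 0 ≤ ∑ k ∈ Finset.range n, u k) (n : ℕ) :
    β n * ∑ k ∈ Finset.range n, u k ≤ ∑ k ∈ Finset.range n, β k * u k := by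
  induction n with
  | zero => simp
  | succ n ih =>
    calc β (n + 1) * ∑ k ∈ Finset.range (n + 1), u k
        ≤ β n * ∑ k ∈ Finset.range (n + 1), u k :=
          mul_le_mul_of_nonneg_right (hβ n.le_succ) (hu _)
      _ = β n * ∑ k ∈ Finset.range n, u k + β n * u n := by rw [Finset.sum_range_succ, mul_add]
      _ ≤ _ := by rw [Finset.sum_range_succ]; linarith

/-- Summation by parts applied to `b - a`, whose partial sums are nonnegative although its terms
need not be. -/
theorem sum_mul_le_sum_mul_of_antitone {β a b : ℕ → ℝ} (hβ : Antitone β) (hβ0 : ∀ n, 0 ≤ β n)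
    (h : ∀ n, ∑ k ∈ Finset.range n, a k ≤ ∑ k ∈ Finset.range n, b k) (n : ℕ) :
    ∑ k ∈ Finset.range n, β k * a k ≤ ∑ k ∈ Finset.range n, β k * b k := by
  have hu : ∀ n, 0 ≤ ∑ k ∈ Finset.range n, (b k - a k) := fun n => by
    rw [Finset.sum_sub_distrib]; linarith [h n]
  have := (mul_nonneg (hβ0 n) (hu n)).trans (mul_sum_le_sum_mul hβ hu n)
  simp only [mul_sub, Finset.sum_sub_distrib] at this
  linarith

/-! ### The Hardy space -/

theorem meanSq_eq_circleAverage {f : 𝔻 → ℂ} {c : ℕ → ℂ} (hf : ∀ z : 𝔻, f z = powerSum c z) {r : ℝ}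
    (h0 : 0 < r) (h1 : r < 1) :
    meanSq f r = Real.circleAverage (fun z => ‖powerSum c z‖ ^ 2) 0 r := by
  refine Real.circleAverage_congr_sphere fun z hz => ?_
  have hz' : ‖z‖ < 1 := by
    have : ‖z‖ = r := by simpa [abs_of_pos h0] using hz
    linarith
  simp [extend, hz', hf]

theorem sum_normSq_le_hardyNorm {f : 𝔻 → ℂ} (hf : f ∈ hardySpace) {c : ℕ → ℂ}
    (hc : ConvergesOnDisc c) (hfc : ∀ z : 𝔻, f z = powerSum c z) (n : ℕ) :
    ∑ k ∈ Finset.range n, ‖c k‖ ^ 2 ≤ hardyNorm f ^ 2 := by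
  have hle : ∀ r : Set.Ioo (0 : ℝ) 1, meanSq f r ≤ ⨆ r : Set.Ioo (0 : ℝ) 1, meanSq f r :=
    fun r => le_ciSup hf.2 r
  have hpos : ∀ r : Set.Ioo (0 : ℝ) 1, 0 ≤ meanSq f r := fun r =>
    Real.circleAverage_nonneg_of_nonneg fun _ _ => sq_nonneg _
  -- The radius `1 / 2` only serves to show that the supremum is nonnegative.
  rw [hardyNorm, Real.sq_sqrt ((hpos ⟨1 / 2, by norm_num, by norm_num⟩).trans (hle _))]
  refine sum_normSq_le_of_forall_lt fun r h0 h1 => ?_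
  refine (sum_normSq_le_circleAverage hc h0 h1 n).trans ?_
  rw [← meanSq_eq_circleAverage hfc h0 h1]
  exact hle ⟨r, h0, h1⟩

/-! ### Operators on spaces with reproducing kernels -/

section Kernels

variable {H : Type*} [NormedAddCommGroup H] [InnerProductSpace ℂ H] [RKHS ℂ H 𝔻 ℂ]
  [CompleteSpace H]

theorem inner_kernelAt (a : 𝔻) (f : H) : ⟪kernelAt H a, f⟫_ℂ = f a := by
  simp [kernelAt]

theorem norm_kernelAt_sq (a : 𝔻) : ‖kernelAt H a‖ ^ 2 = ‖kernelAt H a a‖ := by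
  rw [← inner_kernelAt, inner_self_eq_norm_sq_to_K]
  simp

theorem norm_apply_le_kernelAt (a : 𝔻) (f : H) : ‖f a‖ ≤ ‖kernelAt H a‖ * ‖f‖ := by
  rw [← inner_kernelAt]
  exact norm_inner_le_norm _ _

theorem kernelAt_ne_zero {f : H} {a : 𝔻} (h : f a ≠ 0) : kernelAt H a ≠ 0 := fun h0 => by
  rw [← inner_kernelAt, h0, inner_zero_left] at h
  exact h rfl

/-- In terms of adjoints, `K_z` is an eigenvector of `M*` with eigenvalue `conj (w z)`. Here this is
read off by evaluating `M K_z` at `z`, where `K_z` takes the value `‖K_z‖²`. -/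
theorem norm_le_opNorm_of_mul {M : H →L[ℂ] H} {w : 𝔻 → ℂ}
    (hM : ∀ (f : H) (z : 𝔻), M f z = w z * f z) {z : 𝔻} (hz : kernelAt H z ≠ 0) :
    ‖w z‖ ≤ ‖M‖ := by
  have hpos : 0 < ‖kernelAt H z‖ ^ 2 := by positivity
  refine le_of_mul_le_mul_right ?_ hpos
  calc ‖w z‖ * ‖kernelAt H z‖ ^ 2 = ‖M (kernelAt H z) z‖ := by
        rw [hM, norm_mul, norm_kernelAt_sq]
    _ ≤ ‖kernelAt H z‖ * ‖M (kernelAt H z)‖ := norm_apply_le_kernelAt _ _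
    _ ≤ ‖kernelAt H z‖ * (‖M‖ * ‖kernelAt H z‖) := by gcongr; exact M.le_opNorm _
    _ = _ := by ring

/-- The underlying identity is `C* K_z = K_{φ z}`; it is used by testing `C` on `K_{φ z}` and
evaluating at `z`. -/
theorem norm_kernelAt_comp_le {C : H →L[ℂ] H} {φ : 𝔻 → 𝔻} (hC : ∀ (f : H) (z : 𝔻), C f z = f (φ z))
    (z : 𝔻) : ‖kernelAt H (φ z)‖ ≤ ‖C‖ * ‖kernelAt H z‖ := by
  rcases eq_or_ne (kernelAt H (φ z)) 0 with h | h
  · rw [h, norm_zero]; positivity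
  refine le_of_mul_le_mul_right ?_ (norm_pos_iff.2 h)
  calc ‖kernelAt H (φ z)‖ * ‖kernelAt H (φ z)‖ = ‖C (kernelAt H (φ z)) z‖ := by
        rw [hC, ← norm_kernelAt_sq, sq]
    _ ≤ ‖kernelAt H z‖ * ‖C (kernelAt H (φ z))‖ := norm_apply_le_kernelAt _ _
    _ ≤ ‖kernelAt H z‖ * (‖C‖ * ‖kernelAt H (φ z)‖) := by gcongr; exact C.le_opNorm _
    _ = _ := by ring

/-- A multiplier defines a bounded operator, by the closed graph theorem. -/
theorem exists_mulOperator {w : 𝔻 → ℂ} (hw : w ∈ multipliers H) :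
    ∃ M : H →L[ℂ] H, ∀ (f : H) (z : 𝔻), M f z = w z * f z := by
  choose m hm using hw.2
  let L : H →ₗ[ℂ] H :=
    { toFun := m
      map_add' := fun f g => by
        refine RKHS.ext fun z => ?_
        simp only [RKHS.coe_add, Pi.add_apply, hm, mul_add]
      map_smul' := fun a f => by
        refine RKHS.ext fun z => ?_
        simp only [RKHS.coe_smul, Pi.smul_apply, hm, RingHom.id_apply, smul_eq_mul]
        ring }
  refine ⟨ContinuousLinearMap.ofSeqClosedGraph (g := L) fun u x y hx hy => ?_, fun f z => hm f z⟩
  refine RKHS.ext fun z => ?_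
  -- Norm convergence implies pointwise convergence, so the limit of `L (u n)` has to agree with `w
  -- x` at each point, which closes the graph.
  have hev := RKHS.continuous_eval (H := H) z
  have h1 : Filter.Tendsto (fun n => L (u n) z) Filter.atTop (nhds (y z)) :=
    (hev.tendsto y).comp hy
  have h2 : Filter.Tendsto (fun n => w z * u n z) Filter.atTop (nhds (w z * x z)) :=
    ((hev.tendsto x).comp hx).const_mul _
  have h3 : ∀ n, L (u n) z = w z * u n z := fun n => hm (u n) z
  simp only [h3] at h1
  exact (tendsto_nhds_unique h1 h2).trans (hm x z).symm

end Kernels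

namespace WeightedHardy

variable {β : Weight}

/-! ### The functions in `H²(β)` -/

theorem convergesOnDisc (f : WeightedHardy β) : ConvergesOnDisc f.coeff :=
  .of_summable fun r h0 h1 =>
    summable_eval f (Complex.UnitDisc.mk r (by simpa [abs_of_nonneg h0] using h1))

theorem apply_eq_powerSum (f : WeightedHardy β) (z : 𝔻) : f z = powerSum f.coeff z := rfl

theorem isAnalytic (f : WeightedHardy β) : IsAnalytic f :=
  f.convergesOnDisc.isAnalytic fun _ => rfl

/-- The constant function `a`. -/
def const (β : Weight) (a : ℂ) : WeightedHardy β where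
  coeff := Pi.single 0 a
  summable := summable_of_ne_finset_zero (s := {0}) fun k hk => by
    simp [Pi.single_eq_of_ne (show k ≠ 0 by simpa using hk)]

theorem const_apply (a : ℂ) (z : 𝔻) : const β a z = a := by
  rw [apply_eq, tsum_eq_single 0 fun k hk => by simp [const, Pi.single_eq_of_ne hk]]
  simp [const]

theorem kernelAt_ne_zero (z : 𝔻) : kernelAt (WeightedHardy β) z ≠ 0 :=
  DiscSpaces.kernelAt_ne_zero (f := const β 1) (by simp [const_apply])

/-- Coefficients with bounded weighted square sums define an element of `H²(β)`. -/
theorem exists_of_sum_le {c : ℕ → ℂ} {A : ℝ} (hA : 0 ≤ A)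
    (h : ∀ n, ∑ k ∈ Finset.range n, β k * ‖c k‖ ^ 2 ≤ A ^ 2) :
    ∃ f : WeightedHardy β, f.coeff = c ∧ ‖f‖ ≤ A := by
  have h0 : ∀ k, 0 ≤ β k * ‖c k‖ ^ 2 := fun k => mul_nonneg (β.pos k).le (sq_nonneg _)
  refine ⟨⟨c, summable_of_sum_range_le h0 h⟩, rfl, ?_⟩
  refine le_of_sq_le_sq ?_ hA
  rw [norm_sq]
  exact Real.tsum_le_of_sum_range_le h0 h

theorem sum_le_norm_sq (f : WeightedHardy β) (n : ℕ) :
    ∑ k ∈ Finset.range n, β k * ‖f.coeff k‖ ^ 2 ≤ ‖f‖ ^ 2 := by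
  rw [norm_sq]
  exact f.summable.sum_le_tsum _ fun k _ => mul_nonneg (β.pos k).le (sq_nonneg _)

theorem hardy_embedded (hβ : Antitone β.toFun) {g : 𝔻 → ℂ} (hg : g ∈ hardySpace) :
    ∃ f : WeightedHardy β, ⇑f = g ∧ ‖f‖ ≤ √(β 0) * hardyNorm g := by
  obtain ⟨c, hc, hgc⟩ := hg.1.exists_powerSum
  obtain ⟨f, rfl, hf⟩ := exists_of_sum_le (β := β) (c := c) (A := √(β 0) * hardyNorm g)
    (mul_nonneg (Real.sqrt_nonneg _) (Real.sqrt_nonneg _)) fun n => by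
      rw [mul_pow, Real.sq_sqrt (β.pos 0).le]
      refine le_trans ?_
        (mul_le_mul_of_nonneg_left (sum_normSq_le_hardyNorm hg hc hgc n) (β.pos 0).le)
      rw [Finset.mul_sum]
      exact Finset.sum_le_sum fun k _ =>
        mul_le_mul_of_nonneg_right (hβ (Nat.zero_le k)) (sq_nonneg _)
  exact ⟨f, funext fun z => (hgc z).symm, hf⟩

/-! ### Multiplication by bounded analytic functions -/

/-- The unweighted estimate holds for every partial sum, hence also with the decreasing weight `β`.
The sharp constant `supNorm w` is what later gives equality of norms. -/
theorem exists_mul (hβ : Antitone β.toFun) {w : 𝔻 → ℂ} (hw : w ∈ hInfty) (f : WeightedHardy β) :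
    ∃ g : WeightedHardy β, (∀ z : 𝔻, g z = w z * f z) ∧ ‖g‖ ≤ supNorm w * ‖f‖ := by
  obtain ⟨c, hc, hwc⟩ := hw.1.exists_powerSum
  have hB : ∀ z : ℂ, ‖z‖ < 1 → ‖powerSum c z‖ ≤ supNorm w := fun z hz => by
    have := le_ciSup hw.2 (Complex.UnitDisc.mk z hz)
    simpa only [supNorm, hwc, Complex.UnitDisc.coe_mk] using this
  have hB0 : 0 ≤ supNorm w := (norm_nonneg _).trans (hB 0 (by simp))
  obtain ⟨g, hgc, hg⟩ := exists_of_sum_le (β := β) (c := cauchyProd c f.coeff)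
    (A := supNorm w * ‖f‖) (mul_nonneg hB0 (norm_nonneg _)) fun n => by
      have := sum_mul_le_sum_mul_of_antitone hβ (fun k => (β.pos k).le)
        (a := fun k => ‖cauchyProd c f.coeff k‖ ^ 2)
        (b := fun k => supNorm w ^ 2 * ‖f.coeff k‖ ^ 2)
        (fun n => by
          rw [← Finset.mul_sum]
          exact sum_normSq_cauchyProd_le hc hB f.coeff n) n
      refine this.trans ?_
      rw [mul_pow]
      refine le_trans (le_of_eq ?_) (mul_le_mul_of_nonneg_left (sum_le_norm_sq f n) (sq_nonneg _))
      rw [Finset.mul_sum]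
      exact Finset.sum_congr rfl fun k _ => by ring
  refine ⟨g, fun z => ?_, hg⟩
  rw [apply_eq_powerSum, hgc, powerSum_cauchyProd hc f.convergesOnDisc z.norm_lt_one, hwc]
  rfl

theorem exists_coe_eq (hβ : Antitone β.toFun) {w : 𝔻 → ℂ} (hw : w ∈ hInfty) :
    ∃ u : WeightedHardy β, ⇑u = w := by
  obtain ⟨u, hu, -⟩ := exists_mul hβ hw (const β 1)
  exact ⟨u, funext fun z => by simp [hu, const_apply]⟩

/-- A multiplier acts boundedly by the closed graph theorem, and the norm of this operator bounds it
pointwise because no kernel vanishes. The converse is `exists_mul`, applied also to the constant `1`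
to see that `w` itself lies in the space. -/
theorem multipliers_eq (hβ : Antitone β.toFun) : multipliers (WeightedHardy β) = hInfty := by
  ext w
  constructor
  · intro hw
    obtain ⟨M, hM⟩ := exists_mulOperator hw
    obtain ⟨u, rfl⟩ := hw.1
    refine ⟨u.isAnalytic, ‖M‖, ?_⟩
    rintro _ ⟨z, rfl⟩
    exact norm_le_opNorm_of_mul hM (kernelAt_ne_zero z)
  · intro hw
    refine ⟨exists_coe_eq hβ hw, fun f => ?_⟩
    obtain ⟨g, hg, -⟩ := exists_mul hβ hw f
    exact ⟨g, hg⟩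

theorem exists_mulOperator_norm_eq (hβ : Antitone β.toFun) {w : 𝔻 → ℂ} (hw : w ∈ hInfty) :
    ∃ M : WeightedHardy β →L[ℂ] WeightedHardy β,
      (∀ (f : WeightedHardy β) (z : 𝔻), M f z = w z * f z) ∧ ‖M‖ = supNorm w := by
  obtain ⟨M, hM⟩ := exists_mulOperator (multipliers_eq hβ ▸ hw)
  refine ⟨M, hM, le_antisymm ?_ ?_⟩
  · refine M.opNorm_le_bound (Real.iSup_nonneg fun z => norm_nonneg _) fun f => ?_
    obtain ⟨g, hg, hgn⟩ := exists_mul hβ hw f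
    have : M f = g := RKHS.ext fun z => (hM f z).trans (hg z).symm
    rwa [this]
  · exact ciSup_le fun z => norm_le_opNorm_of_mul hM (kernelAt_ne_zero z)

/-! ### Growth of the kernels -/

theorem kernelAt_eq_evalKernel (a : 𝔻) : kernelAt (WeightedHardy β) a = evalKernel β a :=
  ext_inner_right ℂ fun f => by rw [inner_kernelAt, inner_evalKernel, apply_eq]

theorem norm_kernelAt_sq_eq_tsum (a : 𝔻) :
    ‖kernelAt (WeightedHardy β) a‖ ^ 2 = ∑' k, ‖(a : ℂ)‖ ^ (2 * k) / β k := by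
  rw [kernelAt_eq_evalKernel, norm_sq]
  refine tsum_congr fun k => ?_
  have := (β.pos k).ne'
  simp only [evalKernel, norm_div, norm_pow, RCLike.norm_conj, Complex.norm_real,
    Real.norm_of_nonneg (β.pos k).le]
  field_simp
  ring

/-- The series for `‖K_a‖²` is a power series in `|a|²` with positive coefficients. In particular
points of equal modulus have equal kernel norms, so a point may be rotated onto the positive radius.
-/
theorem norm_kernelAt_mono {a b : 𝔻} (h : ‖(a : ℂ)‖ ≤ ‖(b : ℂ)‖) :
    ‖kernelAt (WeightedHardy β) a‖ ≤ ‖kernelAt (WeightedHardy β) b‖ := by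
  refine le_of_sq_le_sq ?_ (norm_nonneg _)
  rw [norm_kernelAt_sq_eq_tsum, norm_kernelAt_sq_eq_tsum]
  exact (summable_kernel a).tsum_le_tsum (fun k => by
    have := β.pos k
    gcongr) (summable_kernel b)

end WeightedHardy

/-! ### A hyperbolic automorphism -/

theorem norm_shift_div_lt_one {t : ℝ} (ht : |t| < 1) {z : ℂ} (hz : ‖z‖ < 1) :
    ‖(z + t) / (1 + t * z)‖ < 1 := by
  -- The difference of the two sides is `(1 - t²)(1 - |z|²)`.
  have key : ‖z + t‖ ^ 2 < ‖1 + t * z‖ ^ 2 := by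
    have h1 : t ^ 2 < 1 := (sq_lt_one_iff_abs_lt_one t).2 ht
    have h2 : ‖z‖ ^ 2 < 1 := by
      nlinarith [norm_nonneg z]
    rw [← Complex.normSq_eq_norm_sq, Complex.normSq_apply] at h2 ⊢
    rw [← Complex.normSq_eq_norm_sq, Complex.normSq_apply]
    simp only [Complex.add_re, Complex.add_im, Complex.mul_re, Complex.mul_im, Complex.ofReal_re,
      Complex.ofReal_im, Complex.one_re, Complex.one_im]
    nlinarith [mul_pos (sub_pos.2 h1) (sub_pos.2 h2)]
  have h := lt_of_pow_lt_pow_left₀ 2 (norm_nonneg _) key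
  rw [norm_div]
  exact (div_lt_one ((norm_nonneg _).trans_lt h)).2 h

theorem one_add_ofReal_mul_ne_zero {t : ℝ} (ht : |t| < 1) {z : ℂ} (hz : ‖z‖ < 1) :
    1 + t * z ≠ 0 := fun h => by
  have h1 : ‖(t : ℂ) * z‖ < 1 := by
    rw [norm_mul, Complex.norm_real, Real.norm_eq_abs]
    nlinarith [norm_nonneg z, abs_nonneg t]
  rw [eq_neg_of_add_eq_zero_right h, norm_neg, norm_one] at h1
  exact lt_irrefl _ h1

/-- The automorphism `z ↦ (z + t) / (1 + t z)` of the disc, for real `t ∈ (-1, 1)`. -/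
def hyperbolicShift (t : ℝ) (ht : |t| < 1) (z : 𝔻) : 𝔻 :=
  .mk (((z : ℂ) + t) / (1 + t * z)) (norm_shift_div_lt_one ht z.norm_lt_one)

theorem hyperbolicShift_neg_cancel (t : ℝ) (ht : |t| < 1) (ht' : |-t| < 1) (z : 𝔻) :
    hyperbolicShift (-t) ht' (hyperbolicShift t ht z) = z := by
  rw [← Complex.UnitDisc.coe_inj]
  have h1 := one_add_ofReal_mul_ne_zero ht z.norm_lt_one
  have h2 := one_add_ofReal_mul_ne_zero ht' (hyperbolicShift t ht z).norm_lt_one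
  simp only [hyperbolicShift, Complex.UnitDisc.coe_mk] at h2 ⊢
  rw [div_eq_iff h2]
  refine mul_right_cancel₀ h1 ?_
  push_cast
  linear_combination (1 + (t : ℂ) * z) * div_mul_cancel₀ ((z : ℂ) + t) h1

theorem isDiscAutomorphism_hyperbolicShift (t : ℝ) (ht : |t| < 1) :
    IsDiscAutomorphism (hyperbolicShift t ht) := by
  have ht' : |-t| < 1 := by rwa [abs_neg]
  refine ⟨Function.bijective_iff_has_inverse.2 ⟨hyperbolicShift (-t) ht',
    hyperbolicShift_neg_cancel t ht ht', fun z => ?_⟩, ?_⟩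
  · have := hyperbolicShift_neg_cancel (-t) ht' (by rwa [neg_neg]) z
    simpa only [neg_neg] using this
  · have hd : DifferentiableOn ℂ (fun z : ℂ => (z + t) / (1 + t * z)) (Metric.ball 0 1) := by
      intro z hz
      refine DifferentiableAt.differentiableWithinAt (.div (by fun_prop) (by fun_prop) ?_)
      exact one_add_ofReal_mul_ne_zero ht (by simpa using hz)
    refine (hd.analyticOnNhd Metric.isOpen_ball).congr Metric.isOpen_ball fun z hz => ?_
    have hz' : ‖z‖ < 1 := by simpa using hz
    simp [extend, hz', hyperbolicShift]

namespace WeightedHardy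

variable {β : Weight}

/-! ### Comparison of kernel norms along iterates of the automorphism -/

theorem norm_kernelAt_iterate_le {c : ℝ}
    (hc : ∀ z, ‖kernelAt (WeightedHardy β) (hyperbolicShift (1 / 2) (by norm_num) z)‖ ≤
      c * ‖kernelAt (WeightedHardy β) z‖) (hc0 : 0 ≤ c) (b : 𝔻) (n : ℕ) :
    ∃ y : 𝔻, 1 - ‖(y : ℂ)‖ ≤ (1 - ‖(b : ℂ)‖) / 2 ^ n ∧
      ‖kernelAt (WeightedHardy β) y‖ ≤ c ^ n * ‖kernelAt (WeightedHardy β) b‖ := by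
  induction n with
  | zero => exact ⟨b, by simp⟩
  | succ n ih =>
    obtain ⟨y, hy1, hy2⟩ := ih
    set x := ‖(y : ℂ)‖ with hx
    have hx0 : 0 ≤ x := norm_nonneg _
    have hx1 : x < 1 := y.norm_lt_one
    have hxn : ‖(x : ℂ)‖ = x := by simp [abs_of_nonneg hx0]
    -- The shift is sure to move a point towards the boundary only on the positive radius, so `y` is
    -- first replaced by `|y|`, at no cost for the kernel norm.
    set u : 𝔻 := .mk (x : ℂ) (by rwa [hxn]) with hu
    refine ⟨hyperbolicShift (1 / 2) (by norm_num) u, ?_, ?_⟩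
    · have : ‖(hyperbolicShift (1 / 2) (by norm_num) u : ℂ)‖ = (x + 1 / 2) / (1 + 1 / 2 * x) := by
        simp only [hyperbolicShift, hu, Complex.UnitDisc.coe_mk]
        rw [← Complex.norm_of_nonneg (show 0 ≤ (x + 1 / 2) / (1 + 1 / 2 * x) by positivity)]
        push_cast
        rfl
      rw [this, pow_succ, ← div_div]
      refine le_trans ?_ (div_le_div_of_nonneg_right hy1 zero_le_two)
      -- The new distance to the boundary is `(1 - x) / (2 + x)`, at most half the old one.
      rw [one_sub_div (by positivity), div_le_div_iff₀ (by positivity) two_pos]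
      nlinarith
    · refine (hc u).trans ?_
      rw [pow_succ', mul_assoc]
      refine mul_le_mul_of_nonneg_left ((norm_kernelAt_mono ?_).trans hy2) hc0
      rw [hu, Complex.UnitDisc.coe_mk, hxn]

theorem kernel_ratio (haut : AutomorphismsBounded (WeightedHardy β)) :
    ∃ h : ℝ → ℝ, MonotoneOn h (Set.Ici 0) ∧ (∀ t, 0 ≤ t → 0 ≤ h t) ∧
      ∀ a b : 𝔻, ‖kernelAt (WeightedHardy β) a‖ / ‖kernelAt (WeightedHardy β) b‖ ≤
        h ((1 - ‖(b : ℂ)‖) / (1 - ‖(a : ℂ)‖)) := by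
  obtain ⟨C, hC⟩ := haut _ (isDiscAutomorphism_hyperbolicShift (1 / 2) (by norm_num))
  -- The maximum with `1` makes `c ^ n` non-decreasing in `n`.
  set c := max 1 ‖C‖ with hc
  have hc1 : 1 ≤ c := le_max_left _ _
  -- About `log₂ s` steps would do. Taking `⌈s⌉₊` is cruder but enough, since `s ≤ 2 ^ ⌈s⌉₊` and
  -- only monotonicity of `h` is required.
  refine ⟨fun s => c ^ ⌈s⌉₊, fun s _ t _ hst => pow_le_pow_right₀ hc1 (Nat.ceil_mono hst),
    fun t _ => by positivity, fun a b => ?_⟩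
  set s := (1 - ‖(b : ℂ)‖) / (1 - ‖(a : ℂ)‖) with hs
  rw [div_le_iff₀ (norm_pos_iff.2 (kernelAt_ne_zero b))]
  obtain ⟨y, hy1, hy2⟩ := norm_kernelAt_iterate_le (β := β) (c := c)
    (fun z => (norm_kernelAt_comp_le hC z).trans
      (mul_le_mul_of_nonneg_right (le_max_right _ _) (norm_nonneg _)))
    (zero_le_one.trans hc1) b ⌈s⌉₊
  refine (norm_kernelAt_mono ?_).trans hy2
  have ha : 0 < 1 - ‖(a : ℂ)‖ := sub_pos.2 a.norm_lt_one
  have hs2 : s ≤ 2 ^ ⌈s⌉₊ := (Nat.le_ceil s).trans (by exact_mod_cast Nat.lt_two_pow_self.le)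
  have : (1 - ‖(b : ℂ)‖) / 2 ^ ⌈s⌉₊ ≤ 1 - ‖(a : ℂ)‖ := by
    rw [hs, div_le_iff₀ ha] at hs2
    rw [div_le_iff₀ (by positivity), mul_comm]
    exact hs2
  linarith

end WeightedHardy

end DiscSpaces

end

theorem proposition3p13 (β : DiscSpaces.Weight) (hβ : Antitone β.toFun)
    (haut : DiscSpaces.AutomorphismsBounded (DiscSpaces.WeightedHardy β)) :
    DiscSpaces.IsAdmissible (DiscSpaces.WeightedHardy β) ∧
      ∀ w ∈ DiscSpaces.hInfty,
        ∃ M : DiscSpaces.WeightedHardy β →L[ℂ] DiscSpaces.WeightedHardy β,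
          (∀ (f : DiscSpaces.WeightedHardy β) (z : 𝔻), M f z = w z * f z) ∧
            ‖M‖ = DiscSpaces.supNorm w := by
  obtain ⟨h, hmono, hnonneg, hle⟩ := DiscSpaces.WeightedHardy.kernel_ratio haut
  exact ⟨{
    analytic := DiscSpaces.WeightedHardy.isAnalytic
    constants := fun a => ⟨.const β a, DiscSpaces.WeightedHardy.const_apply a⟩
    hardy_embedded := ⟨√(β 0), fun _ hg => DiscSpaces.WeightedHardy.hardy_embedded hβ hg⟩
    multipliers_eq := DiscSpaces.WeightedHardy.multipliers_eq hβ
    automorphisms := haut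
    -- The estimate holds on the whole disc, so any `r < 1` would serve.
    kernel_ratio := ⟨h, hmono, hnonneg, 0, zero_lt_one, fun a b _ _ => hle a b⟩ },
    fun _ hw => DiscSpaces.WeightedHardy.exists_mulOperator_norm_eq hβ hw⟩
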